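/- Let $\mathbb{K}$ be a commutative unital ring and let ${\rm DGCat}$ be the category of small dg categories over $\mathbb{K}$ (cochain complexes, differentials of degree $+1$) and dg functors. A closed morphism $f\colon X\to Y$ of degree $0$ in a dg category is a \emph{homotopy equivalence} if it becomes an isomorphism in the homotopy category $H^0$, i.e. if there are a closed $g\colon Y\to X$ of degree $0$ and morphisms $h_X\in{\rm Hom}(X,X)^{-1}$, $h_Y\in{\rm Hom}(Y,Y)^{-1}$ with $g\circ f-{\rm Id}_X=d(h_X)$ and $f\circ g-{\rm Id}_Y=d(h_Y)$. A dg functor $F\colon\mathcal{C}\to\mathcal{D}$ is a \emph{full isofibration} if (1) for all objects $X,Y$ of $\mathcal{C}$ the cochain map $\mathcal{C}(X,Y)\to\mathcal{D}(F(X),F(Y))$ is surjective, and (2) for any object $X$ of $\mathcal{C}$ and any homotopy equivalence $f\colon F(X)\to Y'$ in $\mathcal{D}$, there is a homotopy equivalence $f'\colon X\to X'$ in $\mathcal{C}$ with $F(X')=Y'$ and $F(f')=f$. View $\mathbb{K}$ as the dg category with a single object $\ast$ and endomorphism algebra $\mathbb{K}\,{\rm Id}_\ast$ in degree $0$, and $\mathbb{K}\coprod\mathbb{K}$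 as the discrete dg category with two objects $\ast_1,\ast_2$. For $n\in\mathbb{Z}$, let $\mathcal{D}(n)$ be the dg category with objects $1,2$, with $\mathcal{D}(n)(i,i)=\mathbb{K}\,{\rm Id}_i$, $\mathcal{D}(n)(2,1)=0$ and $\mathcal{D}(n)(1,2)=\mathbb{K}t\oplus\mathbb{K}dt$ free on $t$, $dt$ with $|t|=-n$, $|dt|=1-n$, $d(t)=dt$, $d(dt)=0$; let $\rho_n\colon\mathbb{K}\coprod\mathbb{K}\to\mathcal{D}(n)$ be the dg functor sending $\ast_i$ to $i$. Let $\mathcal{K}$ be the dg category whose underlying graded category is the graded path category of the quiver with vertices $1,2$ and arrows $f\colon1\to2$, $g\colon2\to1$, $h_1\colon1\to1$, $h_2\colon2\to2$, $r\colon1\to2$ of degrees $|f|=|g|=0$, $|h_1|=|h_2|=-1$, $|r|=-2$, with differential determined by $d(f)=d(g)=0$, $d(h_1)=g\circ f-{\rm Id}_1$, $d(h_2)=f\circ g-{\rm Id}_2$, $d(r)=h_2\circ f-f\circ h_1$; let $\sigma\colon\mathbb{K}\to\mathcal{K}$ be the dg functor sending $\ast$ to $1$. Put $\mathcal{J}=\{\rho_n\mid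 n\in\mathbb{Z}\}\cup\{\sigma\}$. Then the class of full isofibrations equals $\mathcal{J}^\perp$: a dg functor $F$ is a full isofibration if and only if it has the right lifting property with respect to every element of $\mathcal{J}$, i.e. for every $j\in\mathcal{J}$, every commutative square in ${\rm DGCat}$ with left side $j$ and right side $F$ admits a lifting making both triangles commute. -/

import Mathlib

open CategoryTheory

universe u

/-- A small differential graded category over a commutative ring `K`: each `Hom X Y` is a
cochain complex of `K`-modules (with components `Hom X Y n` and differential `d` of degree `+1`),
composition is bilinear of degree zero, unital, associative, and satisfies the graded Leibniz rule
`d (g ∘ f) = d g ∘ f + (-1) ^ |g| • (g ∘ d f)`.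
The composite `g ∘ f` is written `comp h g f`, where `h : |g| + |f| = k` records its degree. -/
structure DGCat (K : Type u) [CommRing K] : Type (u + 1) where
  Obj : Type u
  Hom : Obj → Obj → ℤ → Type u
  [addCommGroup : ∀ X Y n, AddCommGroup (Hom X Y n)]
  [module : ∀ X Y n, Module K (Hom X Y n)]
  d : ∀ {X Y : Obj} {m n : ℤ}, m + 1 = n → (Hom X Y m →ₗ[K] Hom X Y n)
  id : ∀ X : Obj, Hom X X 0
  comp : ∀ {X Y Z : Obj} {m n k : ℤ}, m + n = k →
    (Hom Y Z m →ₗ[K] Hom X Y n →ₗ[K] Hom X Z k)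
  d_d : ∀ {X Y : Obj} {m n k : ℤ} (h₁ : m + 1 = n) (h₂ : n + 1 = k) (f : Hom X Y m),
    d h₂ (d h₁ f) = 0
  id_comp : ∀ {X Y : Obj} {n : ℤ} (h : 0 + n = n) (f : Hom X Y n), comp h (id Y) f = f
  comp_id : ∀ {X Y : Obj} {n : ℤ} (h : n + 0 = n) (f : Hom X Y n), comp h f (id X) = f
  assoc : ∀ {W X Y Z : Obj} {l m n lm mn k : ℤ} (h₁ : l + m = lm) (h₂ : lm + n = k)
    (h₃ : m + n = mn) (h₄ : l + mn = k) (p : Hom Y Z l) (g : Hom X Y m) (f : Hom W X n),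
    comp h₂ (comp h₁ p g) f = comp h₄ p (comp h₃ g f)
  leibniz : ∀ {X Y Z : Obj} {m n k m' n' k' : ℤ} (h : m + n = k) (hm : m + 1 = m')
    (hn : n + 1 = n') (hk : k + 1 = k') (h₁ : m' + n = k') (h₂ : m + n' = k')
    (g : Hom Y Z m) (f : Hom X Y n),
    d hk (comp h g f) = comp h₁ (d hm g) f + m.negOnePow • comp h₂ g (d hn f)

attribute [instance] DGCat.addCommGroup DGCat.module

/-- A dg functor: `K`-linear degreewise, compatible with differentials, identities and
composition. -/
@[ext]
structure DGFunctor {K : Type u} [CommRing K] (C D : DGCat K) : Type u where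
  obj : C.Obj → D.Obj
  map : ∀ {X Y : C.Obj} {n : ℤ}, C.Hom X Y n →ₗ[K] D.Hom (obj X) (obj Y) n
  map_d : ∀ {X Y : C.Obj} {m n : ℤ} (h : m + 1 = n) (f : C.Hom X Y m),
    map (C.d h f) = D.d h (map f)
  map_id : ∀ X : C.Obj, map (C.id X) = D.id (obj X)
  map_comp : ∀ {X Y Z : C.Obj} {m n k : ℤ} (h : m + n = k) (g : C.Hom Y Z m)
    (f : C.Hom X Y n), map (C.comp h g f) = D.comp h (map g) (map f)

namespace DGCat

/-- The category of small dg categories and dg functors. -/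
instance category (K : Type u) [CommRing K] : Category.{u} (DGCat K) where
  Hom C D := DGFunctor C D
  id C :=
    { obj := fun X => X
      map := LinearMap.id
      map_d := fun _ _ => rfl
      map_id := fun _ => rfl
      map_comp := fun _ _ _ => rfl }
  comp F G :=
    { obj := fun X => G.obj (F.obj X)
      map := G.map ∘ₗ F.map
      map_d := fun h f => by simp [F.map_d, G.map_d]
      map_id := fun X => by simp [F.map_id, G.map_id]
      map_comp := fun h g f => by simp [F.map_comp, G.map_comp] }

/-- A closed morphism `f : X → Y` of degree zero is a homotopy equivalence if there are a closed
morphism `g : Y → X` of degree zero and `h_X`, `h_Y` of degree `-1` with `g ∘ f - Id = d h_X` and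
`f ∘ g - Id = d h_Y`, i.e. if its class is invertible in the homotopy category `H⁰`. -/
def IsHomotopyEquiv {K : Type u} [CommRing K] (C : DGCat K) {X Y : C.Obj} (f : C.Hom X Y 0) :
    Prop :=
  C.d (zero_add 1) f = 0 ∧
    ∃ g : C.Hom Y X 0, C.d (zero_add 1) g = 0 ∧
      (∃ hX : C.Hom X X (-1),
        C.comp (add_zero 0) g f - C.id X = C.d (neg_add_cancel 1) hX) ∧
      (∃ hY : C.Hom Y Y (-1),
        C.comp (add_zero 0) f g - C.id Y = C.d (neg_add_cancel 1) hY)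

/-- Full isofibrations: dg functors `F : C ⟶ D` that are surjective on all Hom complexes and such
that each homotopy equivalence `f : F X → Y'` in `D` equals `F f'` for some homotopy equivalence
`f' : X → X'` in `C` (in particular `F X' = Y'`). -/
def fullIsofibration (K : Type u) [CommRing K] : MorphismProperty (DGCat K) :=
  fun C D (F : DGFunctor C D) =>
    (∀ (X Y : C.Obj) (n : ℤ),
      Function.Surjective (F.map : C.Hom X Y n → D.Hom (F.obj X) (F.obj Y) n)) ∧
    ∀ (X : C.Obj) (Y' : D.Obj) (f : D.Hom (F.obj X) Y' 0), D.IsHomotopyEquiv f →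
      ∃ (X' : C.Obj) (f' : C.Hom X X' 0) (hX' : F.obj X' = Y'),
        C.IsHomotopyEquiv f' ∧ hX' ▸ F.map f' = f

end DGCat

/-- A graded quiver: vertices, arrows, and an integer degree for each arrow. -/
structure GradedQuiver : Type (u + 1) where
  V : Type u
  E : V → V → Type u
  deg : ∀ {a b : V}, E a b → ℤ

namespace GradedQuiver

/-- Paths in a graded quiver; `p.cons e` is `p` followed by the arrow `e`, that is `e ∘ p`. -/
inductive Path (Q : GradedQuiver.{u}) (a : Q.V) : Q.V → Type u
  | nil : Path Q a a
  | cons {b c : Q.V} (p : Path Q a b) (e : Q.E b c) : Path Q a c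

/-- Concatenation: `p.comp q` is `p` followed by `q`. -/
def Path.comp {Q : GradedQuiver.{u}} {a b : Q.V} (p : Q.Path a b) :
    ∀ {c : Q.V}, Q.Path b c → Q.Path a c
  | _, .nil => p
  | _, .cons q e => (p.comp q).cons e

@[simp]
theorem Path.comp_nil {Q : GradedQuiver.{u}} {a b : Q.V} (p : Q.Path a b) :
    p.comp Path.nil = p := rfl

@[simp]
theorem Path.comp_cons {Q : GradedQuiver.{u}} {a b c e : Q.V} (p : Q.Path a b) (q : Q.Path b c)
    (x : Q.E c e) : p.comp (q.cons x) = (p.comp q).cons x := rfl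

@[simp]
theorem Path.nil_comp {Q : GradedQuiver.{u}} {a b : Q.V} (p : Q.Path a b) :
    Path.nil.comp p = p := by
  induction p with
  | nil => rfl
  | cons p e ih => rw [Path.comp_cons, ih]

theorem Path.comp_assoc {Q : GradedQuiver.{u}} {a b c e : Q.V} (p : Q.Path a b) (q : Q.Path b c)
    (r : Q.Path c e) : (p.comp q).comp r = p.comp (q.comp r) := by
  induction r with
  | nil => rfl
  | cons r x ih => simp only [Path.comp_cons, ih]

/-- The degree of a path: the sum of the degrees of its arrows. -/
def pathDeg (Q : GradedQuiver.{u}) {a : Q.V} : ∀ {b : Q.V}, Q.Path a b → ℤ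
  | _, .nil => 0
  | _, .cons p e => Q.deg e + pathDeg Q p

theorem pathDeg_comp (Q : GradedQuiver.{u}) {a b c : Q.V} (p : Q.Path a b) (q : Q.Path b c) :
    Q.pathDeg (p.comp q) = Q.pathDeg q + Q.pathDeg p := by
  induction q with
  | nil => simp [pathDeg]
  | cons q e ih => simp only [Path.comp_cons, pathDeg, ih]; ring

variable (K : Type u) [CommRing K] (Q : GradedQuiver.{u})

/-- The free `K`-module on the paths from `a` to `b`: the total Hom module of the path
category `KQ`. -/
abbrev PathMod (a b : Q.V) : Type u := Q.Path a b →₀ K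

/-- The homogeneous component of degree `n` of `PathMod K Q a b`. -/
abbrev homog (a b : Q.V) (n : ℤ) : Submodule K (PathMod K Q a b) :=
  Finsupp.supported K K {p : Q.Path a b | Q.pathDeg p = n}

variable {Q}

/-- A path as a basis element. -/
noncomputable abbrev ofPath {a b : Q.V} (p : Q.Path a b) : PathMod K Q a b := Finsupp.single p 1

/-- An arrow as a basis element. -/
noncomputable abbrev ofArrow {a b : Q.V} (e : Q.E a b) : PathMod K Q a b :=
  ofPath K (Path.cons (Path.nil (a := a)) e)

/-- Bilinear extension of concatenation of paths; `compMod K y x` is `y ∘ x`. -/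
noncomputable def compMod {a b c : Q.V} :
    PathMod K Q b c →ₗ[K] PathMod K Q a b →ₗ[K] PathMod K Q a c :=
  Finsupp.linearCombination K
    (fun q : Q.Path b c => Finsupp.lmapDomain K K (fun p : Q.Path a b => p.comp q))

variable {K}

theorem compMod_single {a b c : Q.V} (p : Q.Path a b) (q : Q.Path b c) (r s : K) :
    compMod K (Finsupp.single q r) (Finsupp.single p s) = Finsupp.single (p.comp q) (r * s) := by
  simp [compMod, Finsupp.mapDomain_single]

theorem compMod_nil_left {a b : Q.V} (x : PathMod K Q a b) :
    compMod K (ofPath K Path.nil) x = x := by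
  induction x using Finsupp.induction_linear with
  | zero => simp
  | add x y hx hy => rw [map_add, hx, hy]
  | single p s => rw [ofPath, compMod_single]; simp

theorem compMod_nil_right {a b : Q.V} (x : PathMod K Q a b) :
    compMod K x (ofPath K Path.nil) = x := by
  induction x using Finsupp.induction_linear with
  | zero => simp
  | add x y hx hy => rw [map_add, LinearMap.add_apply, hx, hy]
  | single p s => rw [ofPath, compMod_single]; simp

theorem compMod_assoc {a b c e : Q.V} (z : PathMod K Q c e) (y : PathMod K Q b c)
    (x : PathMod K Q a b) :
    compMod K (compMod K z y) x = compMod K z (compMod K y x) := by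
  induction z using Finsupp.induction_linear with
  | zero => simp
  | add z z' hz hz' => simp only [map_add, LinearMap.add_apply, hz, hz']
  | single r t =>
    induction y using Finsupp.induction_linear with
    | zero => simp
    | add y y' hy hy' => simp only [map_add, LinearMap.add_apply, hy, hy']
    | single q s =>
      induction x using Finsupp.induction_linear with
      | zero => simp
      | add x x' hx hx' => simp only [map_add, hx, hx']
      | single p v => simp only [compMod_single, Path.comp_assoc, mul_assoc]

theorem ofPath_mem {a b : Q.V} (p : Q.Path a b) {n : ℤ} (h : Q.pathDeg p = n) :
    ofPath K p ∈ homog K Q a b n :=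
  Finsupp.single_mem_supported K 1 h

theorem ofArrow_mem {a b : Q.V} (e : Q.E a b) : ofArrow K e ∈ homog K Q a b (Q.deg e) :=
  ofPath_mem _ (add_zero _)

theorem homog_le {a b : Q.V} {n : ℤ} (S : Submodule K (PathMod K Q a b))
    (h : ∀ p : Q.Path a b, Q.pathDeg p = n → ofPath K p ∈ S) : homog K Q a b n ≤ S := by
  rw [homog, Finsupp.supported_eq_span_single, Submodule.span_le]
  rintro _ ⟨p, hp, rfl⟩
  exact h p hp

theorem compMod_mem {a b c : Q.V} {m n k : ℤ} (h : m + n = k) {y : PathMod K Q b c}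
    {x : PathMod K Q a b} (hy : y ∈ homog K Q b c m) (hx : x ∈ homog K Q a b n) :
    compMod K y x ∈ homog K Q a c k := by
  refine homog_le ((homog K Q a c k).comap ((compMod K).flip x)) (fun q hq => ?_) hy
  refine homog_le ((homog K Q a c k).comap (compMod K (ofPath K q))) (fun p hp => ?_) hx
  simp only [Submodule.mem_comap, ofPath, compMod_single, mul_one]
  exact ofPath_mem _ (by rw [pathDeg_comp, hq, hp, h])

variable (K Q) in
/-- Values of a differential on arrows: `del e` is homogeneous of degree `|e| + 1`. -/
structure Differential where
  del : ∀ {a b : Q.V}, Q.E a b → PathMod K Q a b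
  del_mem : ∀ {a b : Q.V} (e : Q.E a b), del e ∈ homog K Q a b (Q.deg e + 1)

namespace Differential

variable (δ : Differential K Q)

/-- Extension of `δ` to paths by the graded Leibniz rule
`d (e ∘ p) = d e ∘ p + (-1) ^ |e| • (e ∘ d p)`. -/
noncomputable def onPath {a : Q.V} : ∀ {b : Q.V}, Q.Path a b → PathMod K Q a b
  | _, .nil => 0
  | _, .cons p e =>
      compMod K (δ.del e) (ofPath K p) + (Q.deg e).negOnePow • compMod K (ofArrow K e) (onPath p)

/-- The linear extension of `δ` to the path category. -/
noncomputable def dMod (a b : Q.V) : PathMod K Q a b →ₗ[K] PathMod K Q a b :=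
  Finsupp.linearCombination K (fun p => δ.onPath p)

theorem dMod_ofPath {a b : Q.V} (p : Q.Path a b) : δ.dMod a b (ofPath K p) = δ.onPath p := by
  simp [dMod]

theorem dMod_ofArrow {a b : Q.V} (e : Q.E a b) : δ.dMod a b (ofArrow K e) = δ.del e := by
  rw [ofArrow, dMod_ofPath]
  simp only [onPath, map_zero, smul_zero, add_zero]
  exact compMod_nil_right _

theorem onPath_mem {a b : Q.V} (p : Q.Path a b) :
    δ.onPath p ∈ homog K Q a b (Q.pathDeg p + 1) := by
  induction p with
  | nil => exact Submodule.zero_mem _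
  | cons p e ih =>
    refine Submodule.add_mem _ (compMod_mem ?_ (δ.del_mem e) (ofPath_mem p rfl)) ?_
    · simp only [pathDeg]; ring
    · rw [Units.smul_def]
      refine zsmul_mem (compMod_mem ?_ (ofArrow_mem e) ih) _
      simp only [pathDeg]; ring

theorem dMod_mem {a b : Q.V} {m n : ℤ} (h : m + 1 = n) {x : PathMod K Q a b}
    (hx : x ∈ homog K Q a b m) : δ.dMod a b x ∈ homog K Q a b n := by
  refine homog_le ((homog K Q a b n).comap (δ.dMod a b)) (fun p hp => ?_) hx
  rw [Submodule.mem_comap, dMod_ofPath, ← h, ← hp]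
  exact δ.onPath_mem p

theorem dMod_comp_ofPath {a b c : Q.V} (q : Q.Path b c) (x : PathMod K Q a b) :
    δ.dMod a c (compMod K (ofPath K q) x) =
      compMod K (δ.onPath q) x +
        (Q.pathDeg q).negOnePow • compMod K (ofPath K q) (δ.dMod a b x) := by
  induction x using Finsupp.induction_linear with
  | zero => simp
  | add x y hx hy => simp only [map_add, smul_add, hx, hy]; abel
  | single p s =>
    have hs : (Finsupp.single p s : PathMod K Q a b) = s • ofPath K p := by simp
    rw [hs]
    simp only [map_smul, smul_comm _ s, ← smul_add]
    congr 1
    rw [dMod_ofPath]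
    induction q with
    | nil =>
      simp only [onPath, pathDeg, Int.negOnePow_zero, one_smul, map_zero, LinearMap.zero_apply,
        zero_add, compMod_nil_left, dMod_ofPath]
    | cons q e ih =>
      have h1 : compMod K (ofPath K (q.cons e)) (ofPath K p) = ofPath K ((p.comp q).cons e) := by
        simp [ofPath, compMod_single]
      have h2 : compMod K (ofPath K q) (ofPath K p) = ofPath K (p.comp q) := by
        simp [ofPath, compMod_single]
      have h3 : ofPath K (q.cons e) = compMod K (ofArrow K e) (ofPath K q) := by
        simp [ofArrow, ofPath, compMod_single]
      rw [h2, dMod_ofPath] at ih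
      rw [h1, dMod_ofPath]
      simp only [onPath, pathDeg]
      rw [ih, h3, ← h2]
      simp only [map_add, LinearMap.add_apply, Units.smul_def, map_zsmul, LinearMap.smul_apply,
        smul_add, compMod_assoc, Int.negOnePow_add, mul_smul]
      abel

theorem dMod_comp {a b c : Q.V} {m : ℤ} {y : PathMod K Q b c} (hy : y ∈ homog K Q b c m)
    (x : PathMod K Q a b) :
    δ.dMod a c (compMod K y x) =
      compMod K (δ.dMod b c y) x + m.negOnePow • compMod K y (δ.dMod a b x) := by
  have key : homog K Q b c m ≤ LinearMap.eqLocus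
      (δ.dMod a c ∘ₗ (compMod K).flip x)
      ((compMod K).flip x ∘ₗ δ.dMod b c +
        (m.negOnePow : ℤ) • (compMod K).flip (δ.dMod a b x)) := by
    refine homog_le _ (fun q hq => ?_)
    rw [LinearMap.mem_eqLocus]
    simp only [LinearMap.comp_apply, LinearMap.flip_apply, LinearMap.add_apply,
      LinearMap.smul_apply]
    rw [dMod_comp_ofPath, dMod_ofPath, hq, Units.smul_def]
  have := key hy
  rw [LinearMap.mem_eqLocus] at this
  simpa [Units.smul_def] using this

/-- The differential squares to zero as soon as it does so on arrows. -/
theorem dMod_dMod (hδ : ∀ {a b : Q.V} (e : Q.E a b), δ.dMod a b (δ.del e) = 0) {a b : Q.V}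
    (x : PathMod K Q a b) : δ.dMod a b (δ.dMod a b x) = 0 := by
  have hp : ∀ {b : Q.V} (p : Q.Path a b), δ.dMod a b (δ.onPath p) = 0 := by
    intro b p
    induction p with
    | nil => simp [onPath]
    | cons p e ih =>
      have hs := Int.negOnePow_succ (Q.deg e)
      simp only [onPath, map_add, Units.smul_def, map_zsmul]
      rw [δ.dMod_comp (δ.del_mem e), δ.dMod_comp (ofArrow_mem e), hδ, ih, dMod_ofArrow,
        dMod_ofPath, hs]
      simp [Units.smul_def]
  induction x using Finsupp.induction_linear with
  | zero => simp
  | add x y hx hy => simp only [map_add, hx, hy, add_zero]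
  | single p s =>
    have hs : (Finsupp.single p s : PathMod K Q a b) = s • ofPath K p := by simp
    rw [hs, map_smul, map_smul, dMod_ofPath, hp, smul_zero]

end Differential

/-- The dg category whose underlying graded category is the graded path category `KQ`, with
differential determined by its values `δ.del e` on arrows and the Leibniz rule. -/
noncomputable def dgCat (δ : Differential K Q)
    (hδ : ∀ {a b : Q.V} (e : Q.E a b), δ.dMod a b (δ.del e) = 0) : DGCat K where
  Obj := Q.V
  Hom a b n := homog K Q a b n
  d {a b m n} h := (δ.dMod a b).restrict (fun _ hx => δ.dMod_mem h hx)
  id a := ⟨ofPath K Path.nil, ofPath_mem _ rfl⟩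
  comp {a b c m n k} h :=
    LinearMap.mk₂ K (fun y x => ⟨compMod K y.1 x.1, compMod_mem h y.2 x.2⟩)
      (fun _ _ _ => by ext1; simp) (fun _ _ _ => by ext1; simp)
      (fun _ _ _ => by ext1; simp) (fun _ _ _ => by ext1; simp)
  d_d _ _ f := Subtype.ext (δ.dMod_dMod hδ f.1)
  id_comp _ f := Subtype.ext (compMod_nil_left f.1)
  comp_id _ f := Subtype.ext (compMod_nil_right f.1)
  assoc _ _ _ _ p g f := Subtype.ext (compMod_assoc p.1 g.1 f.1)
  leibniz _ _ _ _ _ _ g f := Subtype.ext (by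
    simpa [Units.smul_def, LinearMap.restrict_apply] using δ.dMod_comp g.2 f.1)

section Lift

variable (C : DGCat K) (obj : Q.V → C.Obj)
  (arr : ∀ {a b : Q.V} (e : Q.E a b), C.Hom (obj a) (obj b) (Q.deg e))

/-- The composite in `C` of the images of the arrows of a path. -/
def evalPath {a : Q.V} : ∀ {b : Q.V} (p : Q.Path a b) (n : ℤ), Q.pathDeg p = n →
    C.Hom (obj a) (obj b) n
  | _, .nil, _, h => h ▸ C.id (obj a)
  | _, .cons p e, _, h => C.comp h (arr e) (evalPath p (Q.pathDeg p) rfl)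

open Classical in
/-- Linear extension of `evalPath` to homogeneous elements of the path category. -/
noncomputable def eval {a b : Q.V} {n : ℤ} : homog K Q a b n →ₗ[K] C.Hom (obj a) (obj b) n :=
  Finsupp.linearCombination K
      (fun p : Q.Path a b => if h : Q.pathDeg p = n then evalPath C obj arr p n h else 0) ∘ₗ
    (homog K Q a b n).subtype

theorem eval_ofPath {a b : Q.V} {n : ℤ} (p : Q.Path a b) (h : Q.pathDeg p = n) :
    eval C obj arr ⟨ofPath K p, ofPath_mem p h⟩ = evalPath C obj arr p n h := by
  simp [eval, h]

theorem homog_hom_ext {a b : Q.V} {n : ℤ} {M : Type*} [AddCommGroup M] [Module K M]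
    {φ ψ : homog K Q a b n →ₗ[K] M}
    (h : ∀ (p : Q.Path a b) (hp : Q.pathDeg p = n),
      φ ⟨ofPath K p, ofPath_mem p hp⟩ = ψ ⟨ofPath K p, ofPath_mem p hp⟩) : φ = ψ := by
  have key : homog K Q a b n ≤
      (LinearMap.eqLocus φ ψ).map (homog K Q a b n).subtype :=
    homog_le _ (fun p hp => ⟨⟨ofPath K p, ofPath_mem p hp⟩, h p hp, rfl⟩)
  ext1 x
  obtain ⟨y, hy, hyx⟩ := key x.2
  rw [← Subtype.ext hyx]
  exact hy

theorem evalPath_comp {a b c : Q.V} (p : Q.Path a b) (q : Q.Path b c) {m n k : ℤ}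
    (hp : Q.pathDeg p = n) (hq : Q.pathDeg q = m) (h : m + n = k)
    (hpq : Q.pathDeg (p.comp q) = k) :
    evalPath C obj arr (p.comp q) k hpq =
      C.comp h (evalPath C obj arr q m hq) (evalPath C obj arr p n hp) := by
  subst hp hq h
  induction q with
  | nil =>
    simp only [Path.comp_nil, evalPath]
    have aux : ∀ (m k : ℤ) (h0 : 0 = m) (h : m + Q.pathDeg p = k) (hk : Q.pathDeg p = k),
        evalPath C obj arr p k hk =
          C.comp h (h0 ▸ C.id (obj b) : C.Hom (obj b) (obj b) m)
            (evalPath C obj arr p (Q.pathDeg p) rfl) := by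
      intro m k h0 h hk
      subst h0 hk
      exact (C.id_comp h _).symm
    exact aux _ _ rfl rfl _
  | cons q e ih =>
    simp only [Path.comp_cons, evalPath]
    have aux : ∀ (k : ℤ) (hk : Q.pathDeg (p.comp q) = k)
        (h' : Q.deg e + k = Q.deg e + Q.pathDeg q + Q.pathDeg p)
        (h : Q.deg e + Q.pathDeg (p.comp q) = Q.deg e + Q.pathDeg q + Q.pathDeg p),
        C.comp h (arr e) (evalPath C obj arr (p.comp q) _ rfl) =
          C.comp h' (arr e) (evalPath C obj arr (p.comp q) k hk) := by
      intro k hk h' h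
      subst hk
      rfl
    refine (aux (Q.pathDeg q + Q.pathDeg p) (pathDeg_comp Q p q) (by ring) _).trans ?_
    rw [ih]
    exact (C.assoc _ _ _ _ _ _ _).symm

theorem eval_comp {a b c : Q.V} {m n k : ℤ} (h : m + n = k) (y : homog K Q b c m)
    (x : homog K Q a b n) :
    eval C obj arr ⟨compMod K y.1 x.1, compMod_mem h y.2 x.2⟩ =
      C.comp h (eval C obj arr y) (eval C obj arr x) := by
  have key : ∀ (q : Q.Path b c) (hq : Q.pathDeg q = m) (p : Q.Path a b) (hp : Q.pathDeg p = n),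
      eval C obj arr ⟨compMod K (ofPath K q) (ofPath K p),
        compMod_mem h (ofPath_mem q hq) (ofPath_mem p hp)⟩ =
      C.comp h (evalPath C obj arr q m hq) (evalPath C obj arr p n hp) := by
    intro q hq p hp
    have hpq : Q.pathDeg (p.comp q) = k := by rw [pathDeg_comp, hq, hp, h]
    rw [← evalPath_comp C obj arr p q hp hq h hpq, ← eval_ofPath C obj arr _ hpq]
    congr 2
    simp [ofPath, compMod_single]
  let B : homog K Q b c m →ₗ[K] homog K Q a b n →ₗ[K] homog K Q a c k :=
    LinearMap.mk₂ K (fun y x => ⟨compMod K y.1 x.1, compMod_mem h y.2 x.2⟩)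
      (fun _ _ _ => by ext1; simp) (fun _ _ _ => by ext1; simp)
      (fun _ _ _ => by ext1; simp) (fun _ _ _ => by ext1; simp)
  have hB : B.compr₂ (eval C obj arr) =
      (C.comp h).compl₁₂ (eval C obj arr) (eval C obj arr) := by
    refine homog_hom_ext (fun q hq => homog_hom_ext (fun p hp => ?_))
    rw [LinearMap.compr₂_apply, LinearMap.compl₁₂_apply, eval_ofPath, eval_ofPath]
    exact key q hq p hp
  exact LinearMap.congr_fun (LinearMap.congr_fun hB y) x

theorem d_id_eq_zero (C : DGCat K) (X : C.Obj) {n : ℤ} (h : 0 + 1 = n) : C.d h (C.id X) = 0 := by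
  obtain rfl : n = 1 := by omega
  have := C.leibniz (add_zero 0) h h h (add_zero 1) (zero_add 1) (C.id X) (C.id X)
  rw [C.id_comp, C.comp_id, C.id_comp, Int.negOnePow_zero, one_smul] at this
  simpa using this

theorem eval_d (δ : Differential K Q)
    (harr : ∀ {a b : Q.V} (e : Q.E a b),
      eval C obj arr ⟨δ.del e, δ.del_mem e⟩ = C.d rfl (arr e))
    {a b : Q.V} {m n : ℤ} (h : m + 1 = n) (x : homog K Q a b m) :
    eval C obj arr ⟨δ.dMod a b x.1, δ.dMod_mem h x.2⟩ = C.d h (eval C obj arr x) := by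
  have key : ∀ {b : Q.V} (p : Q.Path a b),
      eval C obj arr ⟨δ.onPath p, δ.onPath_mem p⟩ =
        C.d rfl (evalPath C obj arr p (Q.pathDeg p) rfl) := by
    intro b p
    induction p with
    | nil =>
      have h0 : (⟨δ.onPath (Path.nil (a := a)), δ.onPath_mem _⟩ : homog K Q a a _) = 0 :=
        Subtype.ext rfl
      rw [h0, map_zero]
      exact (d_id_eq_zero C (obj a) rfl).symm
    | @cons b c p e ih =>
      have e1 : (Q.deg e + 1) + Q.pathDeg p = Q.deg e + Q.pathDeg p + 1 := by ring
      have e2 : Q.deg e + (Q.pathDeg p + 1) = Q.deg e + Q.pathDeg p + 1 := by ring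
      have harrow : eval C obj arr ⟨ofArrow K e, ofArrow_mem e⟩ = arr e :=
        (eval_ofPath C obj arr _ (add_zero _)).trans (C.comp_id _ _)
      have hpath := eval_ofPath C obj arr p rfl
      let A : homog K Q a c (Q.deg e + Q.pathDeg p + 1) :=
        ⟨compMod K (δ.del e) (ofPath K p), compMod_mem e1 (δ.del_mem e) (ofPath_mem p rfl)⟩
      let B : homog K Q a c (Q.deg e + Q.pathDeg p + 1) :=
        ⟨compMod K (ofArrow K e) (δ.onPath p), compMod_mem e2 (ofArrow_mem e) (δ.onPath_mem p)⟩
      have hS : eval C obj arr (((Q.deg e).negOnePow : ℤ) • B) =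
          ((Q.deg e).negOnePow : ℤ) • eval C obj arr B := map_zsmul (eval C obj arr) _ B
      change eval C obj arr (A + ((Q.deg e).negOnePow : ℤ) • B) = _
      have hA : eval C obj arr A = _ :=
        eval_comp C obj arr e1 ⟨δ.del e, δ.del_mem e⟩ ⟨ofPath K p, ofPath_mem p rfl⟩
      have hB : eval C obj arr B = _ :=
        eval_comp C obj arr e2 ⟨ofArrow K e, ofArrow_mem e⟩ ⟨δ.onPath p, δ.onPath_mem p⟩
      rw [map_add, hS, hA, hB, harr, ih, harrow, hpath]
      exact (C.leibniz rfl rfl rfl rfl e1 e2 (arr e) _).symm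
  let Dm : homog K Q a b m →ₗ[K] homog K Q a b n :=
    (δ.dMod a b).restrict (fun _ hx => δ.dMod_mem h hx)
  have hD : eval C obj arr ∘ₗ Dm = C.d h ∘ₗ eval C obj arr := by
    refine homog_hom_ext (fun p hp => ?_)
    subst hp
    subst h
    rw [LinearMap.comp_apply, LinearMap.comp_apply, eval_ofPath C obj arr p rfl, ← key p]
    congr 1
    exact Subtype.ext (δ.dMod_ofPath p)
  exact LinearMap.congr_fun hD x

/-- The dg functor out of a path dg category determined by images of vertices and arrows,
compatibly with the differential on arrows. -/
noncomputable def lift (δ : Differential K Q)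
    (hδ : ∀ {a b : Q.V} (e : Q.E a b), δ.dMod a b (δ.del e) = 0)
    (harr : ∀ {a b : Q.V} (e : Q.E a b),
      eval C obj arr ⟨δ.del e, δ.del_mem e⟩ = C.d rfl (arr e)) :
    dgCat δ hδ ⟶ C where
  obj := obj
  map := eval C obj arr
  map_d h f := eval_d C obj arr δ harr h f
  map_id _ := eval_ofPath C obj arr Path.nil rfl
  map_comp h g f := eval_comp C obj arr h g f

end Lift

end GradedQuiver

namespace DGCat

open GradedQuiver

/-- The two objects `1` and `2`. -/
inductive TwoObj : Type u
  | one
  | two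

variable (K : Type u) [CommRing K]

/-- The quiver with vertex set `S` and no arrows. -/
abbrev discreteQuiver (S : Type u) : GradedQuiver.{u} where
  V := S
  E _ _ := PEmpty
  deg e := e.elim

/-- The discrete dg category on a set `S`: its only paths are the trivial ones, so
`Hom X X = K • Id` in degree zero and `Hom X Y = 0` for `X ≠ Y`. -/
noncomputable def discrete (S : Type u) : DGCat K :=
  dgCat (Q := discreteQuiver S)
    { del := fun e => e.elim, del_mem := fun e => e.elim } (fun e => e.elim)

/-- The dg functor out of a discrete dg category with given values on objects. -/
noncomputable def fromDiscrete {S : Type u} (C : DGCat K) (obj : S → C.Obj) : discrete K S ⟶ C :=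
  lift (Q := discreteQuiver S) C obj (fun e => e.elim) _ (fun e => e.elim) (fun e => e.elim)

/-- The dg category `K` with a single object. -/
noncomputable abbrev unit : DGCat K := discrete K PUnit.{u + 1}

/-- The coproduct `K ⨿ K`: the discrete dg category with two objects. -/
noncomputable abbrev twoUnits : DGCat K := discrete K TwoObj.{u}

/-- The two arrows `t, dt : 1 → 2` of the disc. -/
inductive DiscArrow : TwoObj.{u} → TwoObj.{u} → Type u
  | t : DiscArrow .one .two
  | dt : DiscArrow .one .two

/-- The graded quiver of the `n`-th disc, `|t| = -n` and `|dt| = 1 - n`. -/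
abbrev discQuiver (n : ℤ) : GradedQuiver.{u} where
  V := TwoObj
  E := DiscArrow
  deg
    | .t => -n
    | .dt => 1 - n

/-- The differential of the `n`-th disc on arrows, `d t = dt` and `d dt = 0`. -/
noncomputable def discDel (n : ℤ) : ∀ {a b : TwoObj.{u}}, DiscArrow a b →
    PathMod K (discQuiver n) a b
  | _, _, .t => ofArrow K (Q := discQuiver n) DiscArrow.dt
  | _, _, .dt => 0

/-- The differential of the `n`-th disc. -/
noncomputable def discDifferential (n : ℤ) : Differential K (discQuiver.{u} n) where
  del e := discDel K n e
  del_mem e := match e with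
    | .t => ofPath_mem _ (by simp only [pathDeg]; ring)
    | .dt => Submodule.zero_mem _

/-- The `n`-th disc `D(n)`: objects `1` and `2`, `Hom i i = K • Id`, `Hom 2 1 = 0` and
`Hom 1 2 = K t ⊕ K dt`. -/
noncomputable def disc (n : ℤ) : DGCat K :=
  dgCat (discDifferential K n) (by
    rintro _ _ (_ | _)
    · exact (discDifferential K n).dMod_ofArrow (Q := discQuiver n) DiscArrow.dt
    · exact map_zero _)

/-- The dg functor `ρ_n : K ⨿ K ⟶ D(n)`, the identity on objects. -/
noncomputable def rho (n : ℤ) : twoUnits K ⟶ disc K n :=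
  fromDiscrete K (disc K n) (fun i : TwoObj.{u} => i)

/-- The five generating arrows of `𝒦`. -/
inductive KArrow : TwoObj.{u} → TwoObj.{u} → Type u
  | f : KArrow .one .two
  | g : KArrow .two .one
  | h₁ : KArrow .one .one
  | h₂ : KArrow .two .two
  | r : KArrow .one .two

/-- The graded quiver of `𝒦`: `|f| = |g| = 0`, `|h₁| = |h₂| = -1`, `|r| = -2`. -/
abbrev kQuiver : GradedQuiver.{u} where
  V := TwoObj
  E := KArrow
  deg
    | .f => 0
    | .g => 0
    | .h₁ => -1
    | .h₂ => -1
    | .r => -2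

/-- An arrow of the quiver of `𝒦` as an element of its path category. -/
noncomputable abbrev kGen {a b : TwoObj.{u}} (e : KArrow a b) : PathMod K kQuiver.{u} a b :=
  ofArrow K (Q := kQuiver) e

/-- The identity of a vertex in the path category of the quiver of `𝒦`. -/
noncomputable abbrev kId (a : TwoObj.{u}) : PathMod K kQuiver.{u} a a :=
  ofPath K (Path.nil (Q := kQuiver) (a := a))

/-- The differential of `𝒦` on arrows: `d f = d g = 0`, `d h₁ = g ∘ f - Id`,
`d h₂ = f ∘ g - Id` and `d r = h₂ ∘ f - f ∘ h₁`. -/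
noncomputable def kDel : ∀ {a b : TwoObj.{u}}, KArrow a b → PathMod K kQuiver.{u} a b
  | _, _, .f => 0
  | _, _, .g => 0
  | _, _, .h₁ => compMod K (kGen K .g) (kGen K .f) - kId K .one
  | _, _, .h₂ => compMod K (kGen K .f) (kGen K .g) - kId K .two
  | _, _, .r => compMod K (kGen K .h₂) (kGen K .f) - compMod K (kGen K .f) (kGen K .h₁)

/-- The differential of `𝒦`. -/
noncomputable def kDifferential : Differential K kQuiver.{u} where
  del e := kDel K e
  del_mem e := match e with
    | .f => Submodule.zero_mem _
    | .g => Submodule.zero_mem _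
    | .h₁ => Submodule.sub_mem _
        (compMod_mem (add_zero 0) (ofArrow_mem (Q := kQuiver) KArrow.g)
          (ofArrow_mem (Q := kQuiver) KArrow.f)) (ofPath_mem _ rfl)
    | .h₂ => Submodule.sub_mem _
        (compMod_mem (add_zero 0) (ofArrow_mem (Q := kQuiver) KArrow.f)
          (ofArrow_mem (Q := kQuiver) KArrow.g)) (ofPath_mem _ rfl)
    | .r => Submodule.sub_mem _
        (compMod_mem (add_zero (-1)) (ofArrow_mem (Q := kQuiver) KArrow.h₂)
          (ofArrow_mem (Q := kQuiver) KArrow.f))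
        (compMod_mem (zero_add (-1)) (ofArrow_mem (Q := kQuiver) KArrow.f)
          (ofArrow_mem (Q := kQuiver) KArrow.h₁))

theorem kDifferential_sq {a b : TwoObj.{u}} (e : KArrow a b) :
    (kDifferential K).dMod a b (kDel K e) = 0 := by
  have hA : ∀ {a b : TwoObj.{u}} (e : KArrow a b), (kDifferential K).dMod a b (kGen K e) =
      kDel K e :=
    fun e => (kDifferential K).dMod_ofArrow (Q := kQuiver) e
  have hI : ∀ a : TwoObj.{u}, (kDifferential K).dMod a a (kId K a) = 0 :=
    fun a => (kDifferential K).dMod_ofPath (Q := kQuiver) (Path.nil (a := a))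
  have hc : ∀ {a b c : TwoObj.{u}} (e : KArrow b c) (e' : KArrow a b),
      (kDifferential K).dMod a c (compMod K (kGen K e) (kGen K e')) =
        compMod K (kDel K e) (kGen K e') +
          (kQuiver.deg e).negOnePow •
            compMod K (kGen K e) (kDel K e') := by
    intro a b c e e'
    rw [(kDifferential K).dMod_comp (ofArrow_mem (Q := kQuiver) e), hA, hA]
  have hl : ∀ {a b : TwoObj.{u}} (x : PathMod K kQuiver.{u} a b), compMod K (kId K b) x = x :=
    fun x => compMod_nil_left x
  have hr : ∀ {a b : TwoObj.{u}} (x : PathMod K kQuiver.{u} a b), compMod K x (kId K a) = x :=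
    fun x => compMod_nil_right x
  cases e with
  | f => exact map_zero _
  | g => exact map_zero _
  | h₁ =>
    change (kDifferential K).dMod _ _ (compMod K (kGen K .g) (kGen K .f) - kId K .one) = 0
    rw [map_sub, hI, hc]
    simp [kDel]
  | h₂ =>
    change (kDifferential K).dMod _ _ (compMod K (kGen K .f) (kGen K .g) - kId K .two) = 0
    rw [map_sub, hI, hc]
    simp [kDel]
  | r =>
    change (kDifferential K).dMod _ _
      (compMod K (kGen K .h₂) (kGen K .f) - compMod K (kGen K .f) (kGen K .h₁)) = 0
    rw [map_sub, hc, hc]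
    simp only [kDel, map_sub, LinearMap.sub_apply, map_zero, LinearMap.zero_apply,
      smul_zero, add_zero, zero_add, Int.negOnePow_zero, one_smul]
    rw [hl, hr, compMod_assoc, sub_self]

/-- The dg category `𝒦` that freely encodes a homotopy equivalence with its coherence
homotopies. -/
noncomputable def kCat : DGCat K :=
  dgCat (kDifferential K) (fun e => kDifferential_sq K e)

/-- The dg functor `σ : K ⟶ 𝒦` sending the unique object to `1`. -/
noncomputable def sigma : unit K ⟶ kCat K :=
  fromDiscrete K (kCat K) (fun _ => TwoObj.one.{u})

/-- The set `J = {ρ_n | n ∈ ℤ} ∪ {σ}` of dg functors. -/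
def genJ : MorphismProperty (DGCat K) :=
  MorphismProperty.ofHoms (rho K) ⊔ MorphismProperty.ofHoms (fun _ : Unit => sigma K)

end DGCat

namespace DGCat

open GradedQuiver

variable {K : Type u} [CommRing K]

/-! A dg functor out of `disc K n` is a morphism of degree `-n`, and `rho` fixes its endpoints; so
lifting against all `rho K n` is exactly surjectivity on Hom complexes. A dg functor out of `kCat K`
is a homotopy equivalence `f` with chosen `g`, `h₁`, `h₂` and a coherence `r` (`CoherentEquiv`); so
lifting against `sigma` means that such a package starting at `F X` lifts to one starting at `X`.
The isofibration condition only lifts `f`, and the content of the theorem is that the remaining data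
cost nothing.

Downstairs, every `f` extends to a coherent package (`IsHomotopyEquiv.exists_coherentEquiv`), so
lifting packages gives lifting of homotopy equivalences. Conversely, suppose `f` has been lifted. Up
to signs, the matrix with rows `(h₁, g)` and `(r, h₂)` is a contracting homotopy of the formal cone
of `f`; the equation for `d r` is the one entry that a bare homotopy equivalence omits. Composition
with a contraction makes the endomorphism complex of the cone acyclic, by formulas that any dg
functor respects (`CoherentEquiv.exists_primitive`). Hence the kernel of `F` on that complex is
acyclic as well. Arbitrary preimages of `g`, `h₁`, `h₂`, `r` fail the equations by a cocycle in this
kernel, and subtracting a primitive from the kernel repairs them without changing their images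
(`CoherentEquiv.exists_lift`). -/

theorem leibniz_even (C : DGCat K) {X Y Z : C.Obj} {m n k m' n' k' : ℤ} (he : Even m)
    (h : m + n = k) (hm : m + 1 = m') (hn : n + 1 = n') (hk : k + 1 = k') (h₁ : m' + n = k')
    (h₂ : m + n' = k') (g : C.Hom Y Z m) (f : C.Hom X Y n) :
    C.d hk (C.comp h g f) = C.comp h₁ (C.d hm g) f + C.comp h₂ g (C.d hn f) := by
  rw [C.leibniz h hm hn hk h₁ h₂, Int.negOnePow_even m he, one_smul]

theorem leibniz_odd (C : DGCat K) {X Y Z : C.Obj} {m n k m' n' k' : ℤ} (ho : Odd m)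
    (h : m + n = k) (hm : m + 1 = m') (hn : n + 1 = n') (hk : k + 1 = k') (h₁ : m' + n = k')
    (h₂ : m + n' = k') (g : C.Hom Y Z m) (f : C.Hom X Y n) :
    C.d hk (C.comp h g f) = C.comp h₁ (C.d hm g) f - C.comp h₂ g (C.d hn f) := by
  rw [C.leibniz h hm hn hk h₁ h₂, Int.negOnePow_odd m ho, Units.neg_smul, one_smul, sub_eq_add_neg]

/-! ### Coherent equivalences: completion, contractibility, lifting. -/

/-- A homotopy equivalence together with a homotopy inverse, the two homotopies, and a coherence
between them; equivalently, a dg functor out of `kCat K`. -/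
structure CoherentEquiv (C : DGCat K) (X Y : C.Obj) where
  f : C.Hom X Y 0
  g : C.Hom Y X 0
  h₁ : C.Hom X X (-1)
  h₂ : C.Hom Y Y (-1)
  r : C.Hom X Y (-2)
  d_f : C.d (zero_add 1) f = 0
  d_g : C.d (zero_add 1) g = 0
  d_h₁ : C.d (neg_add_cancel 1) h₁ = C.comp (add_zero 0) g f - C.id X
  d_h₂ : C.d (neg_add_cancel 1) h₂ = C.comp (add_zero 0) f g - C.id Y
  d_r : C.d (show (-2 : ℤ) + 1 = -1 by norm_num) r =
    C.comp (add_zero (-1)) h₂ f - C.comp (zero_add (-1)) f h₁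

theorem CoherentEquiv.isHomotopyEquiv {C : DGCat K} {X Y : C.Obj} (c : CoherentEquiv C X Y) :
    C.IsHomotopyEquiv c.f :=
  ⟨c.d_f, c.g, c.d_g, ⟨c.h₁, c.d_h₁.symm⟩, ⟨c.h₂, c.d_h₂.symm⟩⟩

/-- Every homotopy equivalence can be made coherent, by changing one of the homotopies. -/
theorem IsHomotopyEquiv.exists_coherentEquiv {C : DGCat K} {X Y : C.Obj} {f : C.Hom X Y 0}
    (hf : C.IsHomotopyEquiv f) : ∃ c : CoherentEquiv C X Y, c.f = f := by
  obtain ⟨df, g, dg, ⟨h₁, dh₁⟩, ⟨h₂, dh₂⟩⟩ := hf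
  -- The obstruction to finding `r` for the given homotopies. It is closed but need not be exact.
  let e : C.Hom X Y (-1) := C.comp (add_zero (-1)) h₂ f - C.comp (zero_add (-1)) f h₁
  have de : C.d (neg_add_cancel 1) e = 0 := by
    simp only [e, map_sub]
    rw [C.leibniz_odd (by decide) (add_zero (-1)) (neg_add_cancel 1) (zero_add 1)
        (neg_add_cancel 1) (add_zero 0) (neg_add_cancel 1),
      C.leibniz_even (by decide) (zero_add (-1)) (zero_add 1) (neg_add_cancel 1)
        (neg_add_cancel 1) (add_neg_cancel 1) (add_zero 0), ← dh₁, ← dh₂, df]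
    simp only [map_sub, LinearMap.sub_apply, map_zero, LinearMap.zero_apply, C.id_comp, C.comp_id]
    rw [C.assoc (add_zero 0) (add_zero 0) (add_zero 0) (add_zero 0)]
    abel
  -- Adding the closed element `g e` to `h₁` keeps its boundary and changes the obstruction to `e -
  -- f g e = -(d h₂) e`, which is the boundary of `-h₂ e` because `e` is closed.
  refine ⟨⟨f, g, h₁ + C.comp (zero_add (-1)) g e, h₂, -C.comp (by norm_num) h₂ e,
    df, dg, ?_, dh₂.symm, ?_⟩, rfl⟩
  · rw [map_add, ← dh₁, C.leibniz_even (by decide) (zero_add (-1)) (zero_add 1) (neg_add_cancel 1)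
        (neg_add_cancel 1) (add_neg_cancel 1) (add_zero 0), de, dg]
    simp
  · rw [map_neg, C.leibniz_odd (by decide) (by norm_num) (neg_add_cancel 1) (neg_add_cancel 1)
        (by norm_num) (zero_add (-1)) (add_zero (-1)), de, ← dh₂]
    simp only [map_sub, map_add, LinearMap.sub_apply, map_zero, sub_zero, C.id_comp]
    rw [C.assoc (add_zero 0) (zero_add (-1)) (zero_add (-1)) (zero_add (-1))]
    simp only [e]
    abel

/-- Contractibility of the complex governing deformations of a coherent equivalence `c`: a cocycle
in that complex is the coboundary of its product with `c`. -/
theorem CoherentEquiv.exists_primitive {C : DGCat K} {X Y : C.Obj} (c : CoherentEquiv C X Y)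
    (kg : C.Hom Y X 1) (k₁ : C.Hom X X 0) (k₂ : C.Hom Y Y 0) (kr : C.Hom X Y (-1))
    (dkg : C.d one_add_one_eq_two kg = 0)
    (dk₁ : C.d (zero_add 1) k₁ = -C.comp (add_zero 1) kg c.f)
    (dk₂ : C.d (zero_add 1) k₂ = -C.comp (zero_add 1) c.f kg)
    (dkr : C.d (neg_add_cancel 1) kr = C.comp (add_zero 0) c.f k₁ - C.comp (add_zero 0) k₂ c.f) :
    ∃ (γ : C.Hom Y X 0) (η₁ : C.Hom X X (-1)) (η₂ : C.Hom Y Y (-1)) (ρ : C.Hom X Y (-2)),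
    C.d (zero_add 1) γ = kg ∧
    C.d (neg_add_cancel 1) η₁ = k₁ + C.comp (add_zero 0) γ c.f ∧
    C.d (neg_add_cancel 1) η₂ = k₂ + C.comp (add_zero 0) c.f γ ∧
    C.d (show (-2 : ℤ) + 1 = -1 by norm_num) ρ =
      kr + C.comp (add_zero (-1)) η₂ c.f - C.comp (zero_add (-1)) c.f η₁ ∧
    ∀ (D : DGCat K) (F : DGFunctor C D), F.map kg = 0 → F.map k₁ = 0 → F.map k₂ = 0 →
      F.map kr = 0 → F.map γ = 0 ∧ F.map η₁ = 0 ∧ F.map η₂ = 0 ∧ F.map ρ = 0 := by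
  -- Up to signs coming from the shift in the cone, these are the entries of the matrix product of
  -- `(h₁, g; r, h₂)` with `(k₁, kg; kr, k₂)`. Each summand has exactly one entry of the cocycle as
  -- a factor, so a dg functor killing the cocycle kills the primitive; this is the last clause.
  refine ⟨-(C.comp (neg_add_cancel 1) c.h₁ kg + C.comp (add_zero 0) c.g k₂),
    C.comp (zero_add (-1)) c.g kr - C.comp (add_zero (-1)) c.h₁ k₁,
    C.comp (show (-2 : ℤ) + 1 = -1 by norm_num) c.r kg - C.comp (add_zero (-1)) c.h₂ k₂,
    -(C.comp (add_zero (-2)) c.r k₁ + C.comp (show (-1 : ℤ) + -1 = -2 by norm_num) c.h₂ kr),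
    ?_, ?_, ?_, ?_, fun D F Fg F₁ F₂ Fr => ?_⟩
  · simp only [map_neg, map_add]
    rw [C.leibniz_odd (by decide) (neg_add_cancel 1) (neg_add_cancel 1) one_add_one_eq_two
        (zero_add 1) (zero_add 1) (by norm_num),
      C.leibniz_even (by decide) (add_zero 0) (zero_add 1) (zero_add 1)
        (zero_add 1) (add_zero 1) (zero_add 1), c.d_h₁, c.d_g, dkg, dk₂]
    simp only [map_sub, map_neg, LinearMap.sub_apply, map_zero, LinearMap.zero_apply, C.id_comp]
    rw [C.assoc (add_zero 0) (zero_add 1) (zero_add 1) (zero_add 1)]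
    abel
  · simp only [map_neg, map_add, map_sub, LinearMap.neg_apply, LinearMap.add_apply]
    rw [C.leibniz_odd (by decide) (add_zero (-1)) (neg_add_cancel 1) (zero_add 1)
        (neg_add_cancel 1) (add_zero 0) (neg_add_cancel 1),
      C.leibniz_even (by decide) (zero_add (-1)) (zero_add 1) (neg_add_cancel 1)
        (neg_add_cancel 1) (add_neg_cancel 1) (add_zero 0), c.d_h₁, c.d_g, dk₁, dkr]
    simp only [map_sub, map_neg, LinearMap.sub_apply, map_zero, LinearMap.zero_apply, C.id_comp]
    rw [C.assoc (add_zero 0) (add_zero 0) (add_zero 0) (add_zero 0),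
      C.assoc (add_zero 0) (add_zero 0) (add_zero 0) (add_zero 0),
      C.assoc (neg_add_cancel 1) (add_zero 0) (add_zero 1) (neg_add_cancel 1)]
    abel
  · simp only [map_neg, map_add, map_sub]
    rw [C.leibniz_odd (by decide) (add_zero (-1)) (neg_add_cancel 1) (zero_add 1)
        (neg_add_cancel 1) (add_zero 0) (neg_add_cancel 1),
      C.leibniz_even (by decide) (by norm_num) (by norm_num) one_add_one_eq_two
        (neg_add_cancel 1) (neg_add_cancel 1) (by norm_num), c.d_h₂, c.d_r, dk₂, dkg]
    simp only [map_sub, map_neg, LinearMap.sub_apply, map_zero, C.id_comp]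
    rw [C.assoc (add_zero 0) (add_zero 0) (add_zero 0) (add_zero 0),
      C.assoc (add_zero (-1)) (neg_add_cancel 1) (zero_add 1) (neg_add_cancel 1),
      C.assoc (zero_add (-1)) (neg_add_cancel 1) (neg_add_cancel 1) (zero_add 0)]
    abel
  · simp only [map_neg, map_add, map_sub, LinearMap.sub_apply]
    rw [C.leibniz_even (by decide) (add_zero (-2)) (by norm_num) (zero_add 1)
        (by norm_num) (add_zero (-1)) (by norm_num),
      C.leibniz_odd (by decide) (by norm_num) (neg_add_cancel 1) (neg_add_cancel 1)
        (by norm_num) (zero_add (-1)) (add_zero (-1)), c.d_h₂, c.d_r, dk₁, dkr]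
    simp only [map_sub, map_neg, LinearMap.sub_apply, C.id_comp]
    rw [C.assoc (add_zero (-1)) (add_zero (-1)) (add_zero 0) (add_zero (-1)),
      C.assoc (zero_add (-1)) (add_zero (-1)) (add_zero (-1)) (zero_add (-1)),
      C.assoc (add_zero 0) (zero_add (-1)) (zero_add (-1)) (zero_add (-1)),
      C.assoc (add_zero (-1)) (add_zero (-1)) (add_zero 0) (add_zero (-1)),
      C.assoc (by norm_num) (add_zero (-1)) (add_zero 1) (by norm_num)]
    abel
  · simp [F.map_comp, Fg, F₁, F₂, Fr]

/-- Coherent equivalences lift along degreewise surjective dg functors once the underlying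
homotopy equivalence has been lifted. -/
theorem CoherentEquiv.exists_lift {C D : DGCat K} (F : DGFunctor C D)
    (hF : ∀ (X Y : C.Obj) (n : ℤ),
      Function.Surjective (F.map : C.Hom X Y n → D.Hom (F.obj X) (F.obj Y) n))
    {X Y : C.Obj} (c : CoherentEquiv D (F.obj X) (F.obj Y)) (f : C.Hom X Y 0)
    (hf : C.IsHomotopyEquiv f) (hFf : F.map f = c.f) :
    ∃ b : CoherentEquiv C X Y, F.map b.f = c.f ∧ F.map b.g = c.g ∧ F.map b.h₁ = c.h₁ ∧
      F.map b.h₂ = c.h₂ ∧ F.map b.r = c.r := by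
  -- Apart from its `f`, the package `a` is unrelated to `c`: its image under `F` may have another
  -- inverse and other homotopies. It serves only as a contraction upstairs.
  obtain ⟨a, rfl⟩ := hf.exists_coherentEquiv
  obtain ⟨g, hg⟩ := hF _ _ _ c.g
  obtain ⟨h₁, hh₁⟩ := hF _ _ _ c.h₁
  obtain ⟨h₂, hh₂⟩ := hF _ _ _ c.h₂
  obtain ⟨r, hr⟩ := hF _ _ _ c.r
  -- The four defects of the chosen preimages, one for each equation of a coherent equivalence. They
  -- are killed by `F` since `c` satisfies the equations, and applying `d` to their definitions
  -- gives the cocycle relations.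
  obtain ⟨kg, hkg⟩ : ∃ kg, kg = C.d (zero_add 1) g := ⟨_, rfl⟩
  obtain ⟨k₁, hk₁⟩ : ∃ k₁, k₁ =
    C.d (neg_add_cancel 1) h₁ - (C.comp (add_zero 0) g a.f - C.id X) := ⟨_, rfl⟩
  obtain ⟨k₂, hk₂⟩ : ∃ k₂, k₂ =
    C.d (neg_add_cancel 1) h₂ - (C.comp (add_zero 0) a.f g - C.id Y) := ⟨_, rfl⟩
  obtain ⟨kr, hkr⟩ : ∃ kr, kr = C.d (show (-2 : ℤ) + 1 = -1 by norm_num) r -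
    (C.comp (add_zero (-1)) h₂ a.f - C.comp (zero_add (-1)) a.f h₁) := ⟨_, rfl⟩
  have Fkg : F.map kg = 0 := by rw [hkg, F.map_d, hg, c.d_g]
  have Fk₁ : F.map k₁ = 0 := by
    simp only [hk₁, map_sub, F.map_d, F.map_comp, F.map_id, hg, hh₁, hFf, c.d_h₁, sub_self]
  have Fk₂ : F.map k₂ = 0 := by
    simp only [hk₂, map_sub, F.map_d, F.map_comp, F.map_id, hg, hh₂, hFf, c.d_h₂, sub_self]
  have Fkr : F.map kr = 0 := by
    simp only [hkr, map_sub, F.map_d, F.map_comp, hr, hh₁, hh₂, hFf, c.d_r, sub_self]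
  have dkg : C.d one_add_one_eq_two kg = 0 := by rw [hkg, C.d_d]
  have dk₁ : C.d (zero_add 1) k₁ = -C.comp (add_zero 1) kg a.f := by
    simp only [hk₁, map_sub, C.d_d, d_id_eq_zero]
    rw [C.leibniz_even (by decide) (add_zero 0) (zero_add 1) (zero_add 1)
        (zero_add 1) (add_zero 1) (zero_add 1), a.d_f, ← hkg]
    simp
  have dk₂ : C.d (zero_add 1) k₂ = -C.comp (zero_add 1) a.f kg := by
    simp only [hk₂, map_sub, C.d_d, d_id_eq_zero]
    rw [C.leibniz_even (by decide) (add_zero 0) (zero_add 1) (zero_add 1)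
        (zero_add 1) (add_zero 1) (zero_add 1), a.d_f, ← hkg]
    simp
  have dkr : C.d (neg_add_cancel 1) kr =
      C.comp (add_zero 0) a.f k₁ - C.comp (add_zero 0) k₂ a.f := by
    simp only [hkr, hk₁, hk₂, map_sub, C.d_d, LinearMap.sub_apply, C.id_comp, C.comp_id]
    rw [C.leibniz_odd (by decide) (add_zero (-1)) (neg_add_cancel 1) (zero_add 1)
        (neg_add_cancel 1) (add_zero 0) (neg_add_cancel 1),
      C.leibniz_even (by decide) (zero_add (-1)) (zero_add 1) (neg_add_cancel 1)
        (neg_add_cancel 1) (add_neg_cancel 1) (add_zero 0), a.d_f,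
      C.assoc (add_zero 0) (add_zero 0) (add_zero 0) (add_zero 0)]
    simp only [map_zero, LinearMap.zero_apply]
    abel
  obtain ⟨γ, η₁, η₂, ρ, e1, e2, e3, e4, hk⟩ := a.exists_primitive kg k₁ k₂ kr dkg dk₁ dk₂ dkr
  obtain ⟨Fγ, Fη₁, Fη₂, Fρ⟩ := hk D F Fkg Fk₁ Fk₂ Fkr
  -- The terms `γ f`, `f γ`, `η₂ f` and `f η₁` in the equations for the primitive account for the
  -- correction of `g`, `h₁` and `h₂` inside the other equations, so all defects vanish at once.
  refine ⟨⟨a.f, g - γ, h₁ - η₁, h₂ - η₂, r - ρ, a.d_f,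
    by rw [map_sub, e1, hkg, sub_self], ?_, ?_, ?_⟩, hFf, ?_, ?_, ?_, ?_⟩
  · rw [map_sub, e2, hk₁, map_sub, LinearMap.sub_apply]; abel
  · rw [map_sub, e3, hk₂, map_sub]; abel
  · rw [map_sub, e4, hkr, map_sub, map_sub, LinearMap.sub_apply]; abel
  · rw [map_sub, Fγ, hg, sub_zero]
  · rw [map_sub, Fη₁, hh₁, sub_zero]
  · rw [map_sub, Fη₂, hh₂, sub_zero]
  · rw [map_sub, Fρ, hr, sub_zero]

/-! ### Dg functors out of path categories. -/

/-- Paths are composites of arrows and span the Hom modules, so values on arrows determine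
everything. Heterogeneous equality is needed because the two object maps agree only propositionally;
once they are identified, the argument is induction on paths. -/
theorem dgCat_hom_ext {Q : GradedQuiver.{u}} {δ : Differential K Q}
    {hδ : ∀ {a b : Q.V} (e : Q.E a b), δ.dMod a b (δ.del e) = 0} {C : DGCat K}
    (G H : DGFunctor (dgCat δ hδ) C) (hobj : ∀ a : Q.V, G.obj a = H.obj a)
    (harr : ∀ {a b : Q.V} (e : Q.E a b),
      HEq (G.map (X := a) (Y := b) ⟨ofArrow K e, ofArrow_mem e⟩)
        (H.map (X := a) (Y := b) ⟨ofArrow K e, ofArrow_mem e⟩)) : G = H := by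
  revert hobj harr
  obtain ⟨obj, G, -, G_id, G_comp⟩ := G
  obtain ⟨obj', H, -, H_id, H_comp⟩ := H
  intro hobj harr
  obtain rfl : obj = obj' := funext hobj
  have key : ∀ {a b : Q.V} (p : Q.Path a b) (n : ℤ) (hp : Q.pathDeg p = n),
      G (X := a) (Y := b) ⟨ofPath K p, ofPath_mem p hp⟩ = H ⟨ofPath K p, ofPath_mem p hp⟩ := by
    intro a b p
    induction p with
    | nil =>
      rintro n rfl
      exact (G_id a).trans (H_id a).symm
    | @cons b c p e ih =>
      rintro n rfl
      have hc : (⟨ofPath K (p.cons e), ofPath_mem _ rfl⟩ : homog K Q a c _) =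
          (dgCat δ hδ).comp (X := a) (Y := b) (Z := c) rfl ⟨ofArrow K e, ofArrow_mem e⟩
            ⟨ofPath K p, ofPath_mem p rfl⟩ :=
        Subtype.ext (by
          change ofPath K (p.cons e) = compMod K (ofArrow K e) (ofPath K p)
          simp [ofArrow, ofPath, compMod_single])
      refine (congrArg G hc).trans (((G_comp _ _ _).trans ?_).trans (congrArg H hc).symm)
      exact (congrArg₂ (fun y x => C.comp _ y x) (eq_of_heq (harr e)) (ih _ rfl)).trans
        (H_comp _ _ _).symm
  congr 1
  funext a b n
  exact homog_hom_ext fun p hp => key p n hp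

theorem discrete_hom_ext {S : Type u} {C : DGCat K} (G H : DGFunctor (discrete K S) C)
    (hobj : ∀ a : S, G.obj a = H.obj a) : G = H :=
  dgCat_hom_ext (Q := discreteQuiver S) (hδ := fun e => PEmpty.elim e) G H hobj
    fun e => PEmpty.elim e

theorem lift_map_ofArrow {Q : GradedQuiver.{u}} (C : DGCat K) (obj : Q.V → C.Obj)
    (arr : ∀ {a b : Q.V} (e : Q.E a b), C.Hom (obj a) (obj b) (Q.deg e)) {a b : Q.V}
    (e : Q.E a b) : eval C obj arr ⟨ofArrow K e, ofArrow_mem e⟩ = arr e :=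
  (eval_ofPath C obj arr _ (add_zero _)).trans (C.comp_id _ _)

/-! ### What the discs and `kCat` represent. -/

/-- The function on the two objects with values `X` and `Y`. -/
def twoObj {T : Type u} (X Y : T) : TwoObj.{u} → T
  | .one => X
  | .two => Y

/-- The values on arrows of the dg functor out of a disc given by a morphism `x`. -/
def discArr {C : DGCat K} {X Y : C.Obj} {n : ℤ} (x : C.Hom X Y (-n)) :
    ∀ {a b : TwoObj.{u}} (e : DiscArrow a b),
      C.Hom (twoObj X Y a) (twoObj X Y b) ((discQuiver n).deg e)
  | _, _, .t => x
  | _, _, .dt => C.d (by ring) x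

theorem discDifferential_sq (n : ℤ) {a b : TwoObj.{u}} (e : DiscArrow a b) :
    (discDifferential K n).dMod a b ((discDifferential K n).del e) = 0 := by
  cases e with
  | t => exact (discDifferential K n).dMod_ofArrow (Q := discQuiver n) DiscArrow.dt
  | dt => exact map_zero _

/-- The dg functor out of a disc given by a morphism `x`. -/
noncomputable def fromDisc {C : DGCat K} {X Y : C.Obj} {n : ℤ} (x : C.Hom X Y (-n)) :
    disc K n ⟶ C :=
  lift (Q := discQuiver n) C (twoObj X Y) (discArr x) _ (discDifferential_sq n) (by
    rintro _ _ (_ | _)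
    -- The path `dt` has degree `1 - n + 0`, while `d t` sits in degree `-n + 1`. Letting the degree
    -- vary as `k` turns the mismatch into a substitution.
    · have h : ∀ (k : ℤ) (hk : 1 - n + 0 = k) (hk' : -n + 1 = k),
          eval (Q := discQuiver n) C (twoObj X Y) (discArr x)
            ⟨ofArrow K (Q := discQuiver n) .dt, ofPath_mem _ hk⟩ = C.d hk' x := by
        intro k hk hk'
        obtain rfl : 1 - n = k := by omega
        exact lift_map_ofArrow (Q := discQuiver n) C (twoObj X Y) (discArr x) .dt
      exact h (-n + 1) (by ring) rfl
    · refine (map_zero _).trans ?_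
      exact (C.d_d _ _ x).symm)

/-- The values on arrows of the dg functor out of `kCat K` given by a coherent equivalence. -/
def CoherentEquiv.arr {C : DGCat K} {X Y : C.Obj} (c : CoherentEquiv C X Y) :
    ∀ {a b : TwoObj.{u}} (e : KArrow a b),
      C.Hom (twoObj X Y a) (twoObj X Y b) (kQuiver.deg e)
  | _, _, .f => c.f
  | _, _, .g => c.g
  | _, _, .h₁ => c.h₁
  | _, _, .h₂ => c.h₂
  | _, _, .r => c.r

/-- The dg functor out of `kCat K` given by a coherent equivalence. -/
noncomputable def CoherentEquiv.functor {C : DGCat K} {X Y : C.Obj} (c : CoherentEquiv C X Y) :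
    kCat K ⟶ C :=
  lift (Q := kQuiver) C (twoObj X Y) c.arr (kDifferential K) _ (by
    have hA : ∀ {a b : TwoObj.{u}} (e : KArrow a b), eval (Q := kQuiver) C (twoObj X Y) c.arr
        ⟨kGen K e, ofArrow_mem (Q := kQuiver) e⟩ = c.arr e :=
      fun e => lift_map_ofArrow (Q := kQuiver) C (twoObj X Y) c.arr e
    have hI : ∀ a : TwoObj.{u}, eval (Q := kQuiver) C (twoObj X Y) c.arr
        ⟨kId K a, ofPath_mem (Q := kQuiver) Path.nil rfl⟩ = C.id (twoObj X Y a) :=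
      fun a => eval_ofPath (Q := kQuiver) C (twoObj X Y) c.arr Path.nil rfl
    have hc : ∀ {a b b' : TwoObj.{u}} (e : KArrow b b') (e' : KArrow a b) {k : ℤ}
        (h : kQuiver.deg e + kQuiver.deg e' = k),
        eval (Q := kQuiver) C (twoObj X Y) c.arr ⟨compMod K (kGen K e) (kGen K e'),
          compMod_mem h (ofArrow_mem (Q := kQuiver) e) (ofArrow_mem (Q := kQuiver) e')⟩ =
        C.comp h (c.arr e) (c.arr e') := by
      intro a b b' e e' k h
      rw [← hA e, ← hA e']
      exact eval_comp (Q := kQuiver) C (twoObj X Y) c.arr h ⟨kGen K e, _⟩ ⟨kGen K e', _⟩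
    rintro _ _ (_ | _ | _ | _ | _)
    · exact (map_zero _).trans c.d_f.symm
    · exact (map_zero _).trans c.d_g.symm
    · refine ((map_sub _ _ _).trans (congrArg₂ _ (hc .g .f (add_zero 0)) (hI .one))).trans ?_
      exact c.d_h₁.symm
    · refine ((map_sub _ _ _).trans (congrArg₂ _ (hc .f .g (add_zero 0)) (hI .two))).trans ?_
      exact c.d_h₂.symm
    · refine ((map_sub _ _ _).trans (congrArg₂ _ (hc .h₂ .f (add_zero (-1)))
        (hc .f .h₁ (zero_add (-1))))).trans ?_
      exact c.d_r.symm)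

/-- The morphism in `kCat K` given by an arrow. -/
noncomputable abbrev kHom {a b : TwoObj.{u}} (e : KArrow a b) :
    (kCat K).Hom a b (kQuiver.deg e) :=
  ⟨kGen K e, ofArrow_mem (Q := kQuiver) e⟩

theorem CoherentEquiv.functor_map {C : DGCat K} {X Y : C.Obj} (c : CoherentEquiv C X Y)
    {a b : TwoObj.{u}} (e : KArrow a b) : DGFunctor.map c.functor (kHom e) = c.arr e :=
  lift_map_ofArrow (Q := kQuiver) C (twoObj X Y) c.arr e

/-- The image of a coherent equivalence under a dg functor. -/
def CoherentEquiv.map {C D : DGCat K} (F : DGFunctor C D) {X Y : C.Obj}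
    (c : CoherentEquiv C X Y) : CoherentEquiv D (F.obj X) (F.obj Y) where
  f := F.map c.f
  g := F.map c.g
  h₁ := F.map c.h₁
  h₂ := F.map c.h₂
  r := F.map c.r
  d_f := by rw [← F.map_d, c.d_f, map_zero]
  d_g := by rw [← F.map_d, c.d_g, map_zero]
  d_h₁ := by rw [← F.map_d, c.d_h₁, map_sub, F.map_comp, F.map_id]
  d_h₂ := by rw [← F.map_d, c.d_h₂, map_sub, F.map_comp, F.map_id]
  d_r := by rw [← F.map_d, c.d_r, map_sub, F.map_comp, F.map_comp]

variable (K) in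
/-- The tautological coherent equivalence in `kCat K`. -/
noncomputable def CoherentEquiv.universal :
    CoherentEquiv (kCat K) (TwoObj.one : TwoObj.{u}) (TwoObj.two : TwoObj.{u}) where
  f := kHom .f
  g := kHom .g
  h₁ := kHom .h₁
  h₂ := kHom .h₂
  r := kHom .r
  d_f := Subtype.ext ((kDifferential K).dMod_ofArrow (Q := kQuiver) KArrow.f)
  d_g := Subtype.ext ((kDifferential K).dMod_ofArrow (Q := kQuiver) KArrow.g)
  d_h₁ := Subtype.ext ((kDifferential K).dMod_ofArrow (Q := kQuiver) KArrow.h₁)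
  d_h₂ := Subtype.ext ((kDifferential K).dMod_ofArrow (Q := kQuiver) KArrow.h₂)
  d_r := Subtype.ext ((kDifferential K).dMod_ofArrow (Q := kQuiver) KArrow.r)

/-! ### The two lifting properties and their converses. -/

theorem obj_congr {C D : DGCat K} {G H : C ⟶ D} (h : G = H) (X : C.Obj) :
    DGFunctor.obj G X = DGFunctor.obj H X := by rw [h]

theorem map_congr {C D : DGCat K} {G H : C ⟶ D} (h : G = H) {X Y : C.Obj} {n : ℤ}
    (f : C.Hom X Y n) : HEq (DGFunctor.map G f) (DGFunctor.map H f) := by rw [h]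

/-- The square amounts to two objects of `C` and a morphism of `D` between their images, namely the
image of `t`; any preimage of that morphism defines a lift. -/
theorem hasLiftingProperty_rho {C D : DGCat K} (F : C ⟶ D)
    (hF : ∀ (X Y : C.Obj) (n : ℤ), Function.Surjective
      (DGFunctor.map F : C.Hom X Y n → D.Hom (DGFunctor.obj F X) (DGFunctor.obj F Y) n))
    (n : ℤ) : HasLiftingProperty (rho K n) F where
  sq_hasLift {T G} sq := by
    have hobj (a : TwoObj.{u}) : DGFunctor.obj G a = DGFunctor.obj F (DGFunctor.obj T a) :=
      (obj_congr sq.w a).symm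
    -- The endpoints of `G t` are images under `F` only propositionally, so they are first replaced
    -- by variables that can be substituted. The second conjunct takes care of `dt`.
    have key : ∀ A B : D.Obj, DGFunctor.obj F (DGFunctor.obj T TwoObj.one) = A →
        DGFunctor.obj F (DGFunctor.obj T TwoObj.two) = B → ∀ y : D.Hom A B (-n),
        ∃ x : C.Hom (DGFunctor.obj T TwoObj.one) (DGFunctor.obj T TwoObj.two) (-n),
          HEq (DGFunctor.map F x) y ∧
          ∀ m (h : -n + 1 = m), HEq (DGFunctor.map F (C.d h x)) (D.d h y) := by
      rintro _ _ rfl rfl y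
      obtain ⟨x, rfl⟩ := hF _ _ _ y
      exact ⟨x, HEq.rfl, fun m h => heq_of_eq (DGFunctor.map_d F h x)⟩
    let t : (disc K n).Hom TwoObj.one TwoObj.two (-n) :=
      ⟨ofArrow K (Q := discQuiver n) DiscArrow.t, ofArrow_mem (Q := discQuiver n) DiscArrow.t⟩
    let dt : (disc K n).Hom TwoObj.one TwoObj.two (1 - n) :=
      ⟨ofArrow K (Q := discQuiver n) DiscArrow.dt, ofArrow_mem (Q := discQuiver n) DiscArrow.dt⟩
    have hdt : (disc K n).d (by ring) t = dt :=
      Subtype.ext ((discDifferential K n).dMod_ofArrow (Q := discQuiver n) DiscArrow.t)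
    obtain ⟨x, hx, hdx⟩ := key _ _ (hobj .one).symm (hobj .two).symm (DGFunctor.map G t)
    refine ⟨⟨⟨fromDisc x, ?_, ?_⟩⟩⟩
    · exact discrete_hom_ext _ _ (by rintro (_ | _) <;> rfl)
    · refine dgCat_hom_ext (Q := discQuiver n) (hδ := discDifferential_sq n) _ _ ?_ ?_
      · rintro (_ | _)
        · exact (hobj .one).symm
        · exact (hobj .two).symm
      · rintro _ _ (_ | _)
        · refine HEq.trans (heq_of_eq (congrArg (DGFunctor.map F) ?_)) hx
          exact lift_map_ofArrow (Q := discQuiver n) C _ (discArr x) .t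
        · refine (heq_of_eq (congrArg (DGFunctor.map F) ?_)).trans
            ((hdx (1 - n) (by ring)).trans (heq_of_eq ?_))
          · exact lift_map_ofArrow (Q := discQuiver n) C _ (discArr x) .dt
          · exact (DGFunctor.map_d G _ t).symm.trans (congrArg (DGFunctor.map G) hdt)

/-- The bottom of the square is a coherent equivalence starting at an object `F X`. The isofibration
condition supplies the target object and a lift of `f`, and `CoherentEquiv.exists_lift` supplies the
rest, using surjectivity on Hom complexes. -/
theorem hasLiftingProperty_sigma {C D : DGCat K} (F : C ⟶ D) (hF : fullIsofibration K F) :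
    HasLiftingProperty (sigma K) F where
  sq_hasLift {T G} sq := by
    have hobj : DGFunctor.obj F (DGFunctor.obj T PUnit.unit) = DGFunctor.obj G TwoObj.one :=
      obj_congr sq.w PUnit.unit
    have key : ∀ (X : C.Obj) (A B : D.Obj), DGFunctor.obj F X = A → ∀ c : CoherentEquiv D A B,
        ∃ (X' : C.Obj) (b : CoherentEquiv C X X'), DGFunctor.obj F X' = B ∧
          ∀ {v w : TwoObj.{u}} (e : KArrow v w), HEq (DGFunctor.map F (b.arr e)) (c.arr e) := by
      rintro X _ B rfl c
      obtain ⟨X', f, rfl, hf, hFf⟩ := hF.2 X B c.f c.isHomotopyEquiv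
      obtain ⟨b, h⟩ := c.exists_lift F hF.1 f hf hFf
      refine ⟨X', b, rfl, ?_⟩
      rintro _ _ (_ | _ | _ | _ | _)
      exacts [heq_of_eq h.1, heq_of_eq h.2.1, heq_of_eq h.2.2.1, heq_of_eq h.2.2.2.1,
        heq_of_eq h.2.2.2.2]
    -- The functor `G` is turned into data by transporting the tautological package of `kCat K`
    -- along it.
    obtain ⟨X', b, hX', hb⟩ := key _ _ _ hobj ((CoherentEquiv.universal K).map G)
    refine ⟨⟨⟨b.functor, ?_, ?_⟩⟩⟩
    · exact discrete_hom_ext _ _ fun _ => rfl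
    · refine dgCat_hom_ext (Q := kQuiver) _ _ ?_ ?_
      · rintro (_ | _)
        · exact hobj
        · exact hX'
      · intro v w e
        refine (heq_of_eq (congrArg (DGFunctor.map F) (b.functor_map e))).trans ((hb e).trans ?_)
        cases e <;> rfl

/-- The test square has `y` as its bottom map, and the lift evaluated at `t` is a preimage of `y`.
-/
theorem map_surjective_of_rlp {C D : DGCat K} (F : C ⟶ D)
    (hF : ∀ n, HasLiftingProperty (rho K n) F) (X Y : C.Obj) (n : ℤ) : Function.Surjective
      (DGFunctor.map F : C.Hom X Y n → D.Hom (DGFunctor.obj F X) (DGFunctor.obj F Y) n) := by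
  obtain ⟨n, rfl⟩ : ∃ m, n = -m := ⟨-n, (neg_neg n).symm⟩
  intro y
  have w : fromDiscrete K C (twoObj X Y) ≫ F = rho K n ≫ fromDisc y :=
    discrete_hom_ext _ _ (by rintro (_ | _) <;> rfl)
  obtain ⟨⟨L, hL, hLF⟩⟩ := ((hF n).sq_hasLift ⟨w⟩).exists_lift
  have h₁ : DGFunctor.obj L TwoObj.one = X :=
    obj_congr hL TwoObj.one
  have h₂ : DGFunctor.obj L TwoObj.two = Y :=
    obj_congr hL TwoObj.two
  let t : (disc K n).Hom TwoObj.one TwoObj.two (-n) :=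
    ⟨ofArrow K (Q := discQuiver n) DiscArrow.t, ofArrow_mem (Q := discQuiver n) DiscArrow.t⟩
  have ht : HEq (DGFunctor.map F (DGFunctor.map L t)) y := by
    have h : DGFunctor.map (fromDisc y) t = y :=
      lift_map_ofArrow (Q := discQuiver n) D _ (discArr y) .t
    exact (map_congr hLF t).trans (heq_of_eq h)
  generalize DGFunctor.map L t = x at ht
  clear hLF hL w
  subst h₁ h₂
  exact ⟨x, eq_of_heq ht⟩

/-- A bare homotopy equivalence is not yet a functor out of `kCat K`, since `r` is missing; it is
completed first. Lifting against `sigma` then lifts the whole package, of which only the component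
`f` and its being a homotopy equivalence are kept. -/
theorem exists_isHomotopyEquiv_of_rlp {C D : DGCat K} (F : C ⟶ D)
    [HasLiftingProperty (sigma K) F] (X : C.Obj) (Y : D.Obj) (f : D.Hom (DGFunctor.obj F X) Y 0)
    (hf : D.IsHomotopyEquiv f) : ∃ (X' : C.Obj) (f' : C.Hom X X' 0)
      (hX' : DGFunctor.obj F X' = Y), C.IsHomotopyEquiv f' ∧ hX' ▸ DGFunctor.map F f' = f := by
  obtain ⟨c, rfl⟩ := hf.exists_coherentEquiv
  have w : fromDiscrete K C (fun _ : PUnit => X) ≫ F = sigma K ≫ c.functor :=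
    discrete_hom_ext _ _ fun _ => rfl
  obtain ⟨⟨L, hL, hLF⟩⟩ := (HasLiftingProperty.sq_hasLift (i := sigma K) (p := F)
    ⟨w⟩).exists_lift
  have h₁ : DGFunctor.obj L TwoObj.one = X :=
    obj_congr hL PUnit.unit
  have h₂ : DGFunctor.obj F (DGFunctor.obj L TwoObj.two) = Y :=
    obj_congr hLF TwoObj.two
  have ht : HEq (DGFunctor.map F ((CoherentEquiv.universal K).map L).f) c.f :=
    (map_congr hLF (kHom KArrow.f)).trans (heq_of_eq (c.functor_map .f))
  have hb := ((CoherentEquiv.universal K).map L).isHomotopyEquiv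
  generalize ((CoherentEquiv.universal K).map L).f = b at ht hb
  clear hLF hL w hf
  subst h₁ h₂
  exact ⟨_, b, rfl, hb, eq_of_heq ht⟩

end DGCat

theorem mainTheorem6 (K : Type u) [CommRing K] :
    DGCat.fullIsofibration K = (DGCat.genJ K).rlp := by
  ext C D F
  constructor
  · rintro hF _ _ _ (⟨⟨n⟩⟩ | ⟨⟨⟩⟩)
    · exact DGCat.hasLiftingProperty_rho F hF.1 n
    · exact DGCat.hasLiftingProperty_sigma F hF
  · intro hF
    have hσ : HasLiftingProperty (DGCat.sigma K) F := hF _ (Or.inr ⟨()⟩)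
    exact ⟨DGCat.map_surjective_of_rlp F fun n => hF _ (Or.inl ⟨n⟩),
      DGCat.exists_isHomotopyEquiv_of_rlp F⟩
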